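/- Let $K$ be a complex Hilbert space, $N\ge 2$, and let $V_0,\dots,V_{N-1}$ be bounded operators on $K$ forming a row co-isometry: $\sum_{i=0}^{N-1}V_iV_i^*=I_K$. Let $\mathcal T$ be a complete metric space and $e:\mathcal T\to K$, $t\mapsto e_t$, a continuous map with $\|e_t\|=1$ for all $t$, such that the closed linear span of $\{e_t:t\in\mathcal T\}$ is $K$. Suppose that $V_i^*e_t=\nu_i(t)e_{g_i(t)}$ for all $i$ and $t$, with $\nu_i(t)\in\mathbb C$ and $g_i(t)\in\mathcal T$, where every map $g_i:\mathcal T\to\mathcal T$ is a contraction (with ratio $<1$). Notation. $\Omega$ is the set of finite words over $\{0,\dots,N-1\}$, including the empty word. For $\omega=\omega_1\cdots\omega_n\in\Omega$ put $V_\omega=V_{\omega_1}\cdots V_{\omega_n}$, $g_\omega=g_{\omega_n}\circ\cdots\circ g_{\omega_1}$ and $\nu_\omega(t)=\nu_{\omega_1}(t)\,\nu_{\omega_2}(g_{\omega_1}(t))\cdots\nu_{\omega_n}(g_{\omega_{n-1}}\cdots g_{\omega_1}(t))$; for the empty word these are the identity, the identity and $1$. A set $M\subseteq\mathcal T$ is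 invariant if $t\in M$ and $\nu_i(t)\ne0$ imply $g_i(t)\in M$. A minimal compact invariant set is a nonempty compact invariant set that has no proper nonempty compact invariant subset. Let $K(M)$ be the closed linear span of $\{e_t:t\in M\}$. For an invariant set $M$, $g_i|_M:M\to M$ denotes the map equal to $g_i(c)$ where $g_i(c)\in M$; at points $c\in M$ with $g_i(c)\notin M$, where necessarily $\nu_i(c)=0$, its value is immaterial and is set to be $c$. Assume in addition that all the maps $g_i$ are injective and that all minimal compact invariant sets are finite. Then there are only finitely many minimal compact invariant sets $M_1,\dots,M_p$ (listed without repetition), and for every $j$ the family $(V_i)$ acts on $K(M_j)$ as an irreducible, separating random walk $(M_j,\{g_i|_{M_j}\},\{\nu_i|_{M_j}\})$. That is: - $M_j$ is finite, $K(M_j)$ is a closed subspace invariant under all $V_i^*$, $(e_c)_{c\in M_j}$ is an orthonormal basis of $K(M_j)$, $V_i^*e_c=\nu_i(c)e_{g_i|_{M_j}(c)}$ for all $i$ and all $c\in M_j$, and whenever $c,c'\in M_j$, $\nu_i(c)\ne0$, $\nu_i(c')\neq 0$ and $g_i(c)=g_i(c')$, then $c=c'$; - (irreducible) for all $c,c'\in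 M_j$ there is $\omega\in\Omega$ with $g_\omega(c)=c'$ and $\nu_\omega(c)\ne0$; - (separating) for all $c\ne c'$ in $M_j$ there is $n$ such that for every $\omega\in\Omega$ of length at least $n$, $\nu_\omega(c)=0$ or $\nu_\omega(c')=0$ (in the last two items $g_\omega$ and $\nu_\omega$ are formed from the restricted maps and weights). Suppose moreover that $(V_i)$ is reversing on each $K(M_j)$, that is, $V_ie_{g_i(c)}=\overline{\nu_i(c)}\,e_c$ for all $c\in M_j$ and all $i$ with $\nu_i(c)\neq0$. For each $j=1,\dots,p$ choose any point $c_j\in M_j$. A cycle word for $c_j$ is a nonempty word $\beta=\beta_1\cdots\beta_m$ with $g_\beta(c_j)=c_j$, $\nu_\beta(c_j)\ne0$ and $g_{\beta_1\cdots\beta_k}(c_j)\neq c_j$ for $1\le k<m$ (again with the restricted maps and weights). Let $\Omega_{c_j}^{(0)}$ be the set of words in $\Omega$ that do not end in a cycle word for $c_j$. Then the family $\{V_\omega e_{c_j}:\omega\in\Omega_{c_j}^{(0)},\ j=1,\dots,p\}$, indexed by the pairs $(j,\omega)$, is a Parseval frame for $K$: $$\|v\|^2=\sum_{j=1}^p\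 \sum_{\omega\in\Omega_{c_j}^{(0)}}|\langle v,V_\omega e_{c_j}\rangle|^2\qquad(v\in K).$$ -/

import Mathlib

noncomputable section

/-- `(K, V_i)_{i < N}` is a row co-isometry: `N ≥ 2` and `∑ i, V_i V_i^* = I_K`. -/
def IsRowCoisometry {K : Type*} [NormedAddCommGroup K] [InnerProductSpace ℂ K] [CompleteSpace K]
    {N : ℕ} (V : Fin N → K →L[ℂ] K) : Prop :=
  2 ≤ N ∧ ∑ i, V i ∘L ContinuousLinearMap.adjoint (V i) = ContinuousLinearMap.id ℂ K

/-- `V_ω = V_{ω_1} ⋯ V_{ω_n}` for a word `ω = ω_1 … ω_n`; the identity for the empty word. -/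
def wordOp {K : Type*} [NormedAddCommGroup K] [InnerProductSpace ℂ K] {N : ℕ}
    (V : Fin N → K →L[ℂ] K) : List (Fin N) → K →L[ℂ] K
  | [] => ContinuousLinearMap.id ℂ K
  | i :: ω => V i ∘L wordOp V ω

/-- `g_ω = g_{ω_n} ∘ ⋯ ∘ g_{ω_1}` for a word `ω = ω_1 … ω_n` (the first letter acts first). -/
def wordMap {X : Type*} {N : ℕ} (g : Fin N → X → X) : List (Fin N) → X → X
  | [], x => x
  | i :: ω, x => wordMap g ω (g i x)

/-- `ν_ω(x) = ν_{ω_1}(x) ν_{ω_2}(g_{ω_1} x) ⋯ ν_{ω_n}(g_{ω_{n-1}} ⋯ g_{ω_1} x)`. -/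
def wordWeight {X : Type*} {N : ℕ} (g : Fin N → X → X) (ν : Fin N → X → ℂ) :
    List (Fin N) → X → ℂ
  | [], _ => 1
  | i :: ω, x => ν i x * wordWeight g ν ω (g i x)

/-- `(V_i)` acts on the closed subspace `K₀` as a random walk on the graph `(M, {g_i}, {ν_i})`,
with orthonormal basis `(e_c)_{c ∈ M}` of `K₀`. -/
structure ActsAsRandomWalk {K : Type*} [NormedAddCommGroup K] [InnerProductSpace ℂ K]
    [CompleteSpace K] {N : ℕ} (V : Fin N → K →L[ℂ] K) (K₀ : Submodule ℂ K) {M : Type*}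
    (e : M → K) (g : Fin N → M → M) (ν : Fin N → M → ℂ) : Prop where
  closed : IsClosed (K₀ : Set K)
  invariant : ∀ i, ∀ x ∈ K₀, ContinuousLinearMap.adjoint (V i) x ∈ K₀
  finite : Finite M
  orthonormal : Orthonormal ℂ e
  span_eq : (Submodule.span ℂ (Set.range e)).topologicalClosure = K₀
  adjoint_apply : ∀ i c, ContinuousLinearMap.adjoint (V i) (e c) = ν i c • e (g i c)
  inj : ∀ i c₁ c₂, ν i c₁ ≠ 0 → ν i c₂ ≠ 0 → g i c₁ = g i c₂ → c₁ = c₂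

/-- The random walk `(M, {g_i}, {ν_i})` is irreducible. -/
def WalkIrreducible {M : Type*} {N : ℕ} (g : Fin N → M → M) (ν : Fin N → M → ℂ) : Prop :=
  ∀ c₁ c₂ : M, ∃ ω : List (Fin N), wordMap g ω c₁ = c₂ ∧ wordWeight g ν ω c₁ ≠ 0

/-- The random walk `(M, {g_i}, {ν_i})` is separating. -/
def WalkSeparating {M : Type*} {N : ℕ} (g : Fin N → M → M) (ν : Fin N → M → ℂ) : Prop :=
  ∀ c₁ c₂ : M, c₁ ≠ c₂ → ∃ n : ℕ, ∀ ω : List (Fin N), n ≤ ω.length →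
    wordWeight g ν ω c₁ = 0 ∨ wordWeight g ν ω c₂ = 0

/-- `{V_i}` is reversing on the random walk `(M, {g_i}, {ν_i})` with basis `(e_c)`. -/
def WalkReversing {K : Type*} [NormedAddCommGroup K] [InnerProductSpace ℂ K] {N : ℕ}
    (V : Fin N → K →L[ℂ] K) {M : Type*} (e : M → K) (g : Fin N → M → M)
    (ν : Fin N → M → ℂ) : Prop :=
  ∀ i c, ν i c ≠ 0 → V i (e (g i c)) = (starRingEnd ℂ) (ν i c) • e c

/-- `β` is a cycle word for `c`: a nonempty word that leads with nonzero weight from `c` to `c`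
without visiting `c` in between. -/
def IsCycleWord {M : Type*} {N : ℕ} (g : Fin N → M → M) (ν : Fin N → M → ℂ) (c : M)
    (β : List (Fin N)) : Prop :=
  β ≠ [] ∧ wordMap g β c = c ∧ (∀ k, 0 < k → k < β.length → wordMap g (β.take k) c ≠ c) ∧
    wordWeight g ν β c ≠ 0

/-- The set of words that do not end in a cycle word for `c`. -/
def wordsNotEndingInCycle {M : Type*} {N : ℕ} (g : Fin N → M → M) (ν : Fin N → M → ℂ) (c : M) :
    Set (List (Fin N)) :=
  {ω | ∀ β, IsCycleWord g ν c β → ¬ β <:+ ω}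

/-- The assumptions on a row co-isometry: a norm-one continuous map `e : T → K` on a complete
metric space, whose range has dense linear span, with `V_i^* e_t = ν_i(t) e_{g_i(t)}` for
contractions `g_i` of `T`. -/
structure CoisometryAssumptions {K : Type*} [NormedAddCommGroup K] [InnerProductSpace ℂ K]
    [CompleteSpace K] {T : Type*} [MetricSpace T] [CompleteSpace T] {N : ℕ}
    (V : Fin N → K →L[ℂ] K) (e : T → K) (g : Fin N → T → T) (ν : Fin N → T → ℂ) : Prop where
  coisometry : IsRowCoisometry V
  continuous : Continuous e
  dense_span : (Submodule.span ℂ (Set.range e)).topologicalClosure = ⊤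
  norm_eq_one : ∀ t, ‖e t‖ = 1
  adjoint_apply : ∀ i t, ContinuousLinearMap.adjoint (V i) (e t) = ν i t • e (g i t)
  contraction : ∀ i, ∃ κ : NNReal, ContractingWith κ (g i)

/-- `M ⊆ T` is invariant: possible transitions from points of `M` stay in `M`. -/
def IsInvariantSet {T : Type*} {N : ℕ} (g : Fin N → T → T) (ν : Fin N → T → ℂ)
    (M : Set T) : Prop :=
  ∀ t ∈ M, ∀ i, ν i t ≠ 0 → g i t ∈ M

/-- Minimal compact invariant sets: minimal among the nonempty compact invariant sets. -/
def IsMinimalCompactInvariant {T : Type*} [TopologicalSpace T] {N : ℕ} (g : Fin N → T → T)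
    (ν : Fin N → T → ℂ) (M : Set T) : Prop :=
  Minimal (fun A : Set T => A.Nonempty ∧ IsCompact A ∧ IsInvariantSet g ν A) M

/-- `K(M)`, the closed linear span of the vectors `e_t`, `t ∈ M`. -/
def spanOn {K : Type*} [NormedAddCommGroup K] [InnerProductSpace ℂ K] {T : Type*} (e : T → K)
    (M : Set T) : Submodule ℂ K :=
  (Submodule.span ℂ (e '' M)).topologicalClosure

open Classical in
/-- The restriction of the maps `g_i` to `M`, as maps `M → M`. If `M` is invariant and
`ν_i(c) ≠ 0` the value at `c` is `g_i(c)`. Where `g_i(c)` is not in `M` (so that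
`ν_i(c) = 0`, and no edge starts at `c` with label `i`) the value is immaterial, and is put
equal to `c`. -/
def restrictMaps {T : Type*} {N : ℕ} (g : Fin N → T → T) (M : Set T) (i : Fin N) (c : M) : M :=
  if h : g i c ∈ M then ⟨g i c, h⟩ else c

/-- The restriction of the weights `ν_i` to `M`. -/
def restrictWeights {T : Type*} {N : ℕ} (ν : Fin N → T → ℂ) (M : Set T) (i : Fin N) (c : M) : ℂ :=
  ν i c

/-- The family `(f_a)` is a Parseval frame: `‖v‖² = ∑ a, |⟨v, f_a⟩|²` for all `v`. -/
def IsParsevalFrame {K : Type*} [NormedAddCommGroup K] [InnerProductSpace ℂ K] {A : Type*}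
    (f : A → K) : Prop :=
  ∀ v : K, HasSum (fun a => ‖inner ℂ v (f a)‖ ^ 2) (‖v‖ ^ 2)

end

/-!
The energy `E v = ∑ |⟨v, V_ω e_{c_j}⟩|²` of the family is compared with `‖v‖²`. The words not ending
in a cycle word are stable under removing the first letter, and no `V_ω e_{c_j}` with `ω` nonempty
sees the base vectors; induction on the length, stripping first letters by means of
`∑ ‖V_i^* v‖² = ‖v‖²`, therefore gives `E v ≤ ‖v‖²`. For reversing walks, prefixing a letter either
keeps a word in the index set or produces a cycle word, which only rescales `e_{c_j}`; this yields
`∑ E (V_i^* v) ≤ E v`. Hence `p t = E e_t` is continuous and superharmonic,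
`∑ |ν_i t|² p (g_i t) ≤ p t`, so the set where it attains its minimum over a compact set stable
under all `g_i` is invariant and contains some `M_j`. As `p = 1` at `c_j`, and `p ≤ 1` everywhere,
`p = 1` throughout. The analysis operator is thus a contraction preserving the norms of the `e_t`,
which span a dense subspace, and so it is an isometry.

Different points of the minimal sets give orthogonal vectors because the contractions `g_i` would
bring two points joined to long common words closer together than the minimal distance of a finite
set. All minimal sets lie in one compact set, where an orthonormal family `e_{c_j}` must be finite.
-/

open scoped ENNReal InnerProductSpace lp

section Frame

variable {K : Type*} [NormedAddCommGroup K] [InnerProductSpace ℂ K] {A : Type*} {f : A → K}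

/-- The energy `∑ a, |⟨v, f_a⟩|²` of `v` with respect to the family `(f_a)`, with values in
`[0, ∞]` so that no summability is presupposed. -/
noncomputable def frameEnergy (f : A → K) (v : K) : ℝ≥0∞ := ∑' a, ‖⟪v, f a⟫_ℂ‖ₑ ^ 2

theorem frameEnergy_smul (c : ℂ) (v : K) :
    frameEnergy f (c • v) = ‖c‖ₑ ^ 2 * frameEnergy f v := by
  simp only [frameEnergy, inner_smul_left, enorm_mul, mul_pow, ENNReal.tsum_mul_left,
    RCLike.enorm_conj]

/-- A Bessel family with bound `1`. -/
def IsBesselFamily (f : A → K) : Prop := ∀ v, frameEnergy f v ≤ ‖v‖ₑ ^ 2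

theorem isBesselFamily_of_orthonormal (hf : Orthonormal ℂ f) : IsBesselFamily f := fun v => by
  refine ENNReal.summable.tsum_le_of_sum_le fun s => ?_
  simp only [← ofReal_norm, ← ENNReal.ofReal_pow (norm_nonneg _)]
  rw [← ENNReal.ofReal_sum_of_nonneg fun _ _ => sq_nonneg _]
  refine ENNReal.ofReal_le_ofReal ?_
  simpa only [norm_inner_symm v] using hf.sum_inner_products_le v

namespace IsBesselFamily

theorem hasSum (hf : IsBesselFamily f) (v : K) :
    HasSum (fun a => ‖⟪v, f a⟫_ℂ‖ ^ 2) (frameEnergy f v).toReal := by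
  have h := ENNReal.hasSum_toReal ((hf v).trans_lt (by finiteness)).ne
  rw [frameEnergy, ENNReal.tsum_toReal_eq fun a => by finiteness]
  simpa only [ENNReal.toReal_pow, toReal_enorm] using h

theorem toReal_frameEnergy_le (hf : IsBesselFamily f) (v : K) :
    (frameEnergy f v).toReal ≤ ‖v‖ ^ 2 := by
  simpa using ENNReal.toReal_mono (by finiteness) (hf v)

theorem memℓp (hf : IsBesselFamily f) (v : K) : Memℓp (fun a => ⟪f a, v⟫_ℂ) 2 := by
  refine memℓp_gen ?_
  simpa [norm_inner_symm v] using (hf.hasSum v).summable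

/-- The analysis operator `v ↦ (⟨f_a, v⟩)_a` of a Bessel family, as a linear map to `ℓ²`. -/
noncomputable def analysisMap (hf : IsBesselFamily f) : K →ₗ[ℂ] ℓ²(A, ℂ) where
  toFun v := ⟨fun a => ⟪f a, v⟫_ℂ, hf.memℓp v⟩
  map_add' v w := by ext a; exact inner_add_right _ _ _
  map_smul' c v := by ext a; exact inner_smul_right _ _ _

theorem norm_analysisMap_sq (hf : IsBesselFamily f) (v : K) :
    ‖hf.analysisMap v‖ ^ 2 = (frameEnergy f v).toReal := by
  have h := lp.norm_rpow_eq_tsum (p := 2) (by norm_num) (hf.analysisMap v)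
  simp only [ENNReal.toReal_ofNat, Real.rpow_two] at h
  rw [h, ← (hf.hasSum v).tsum_eq]
  simp only [norm_inner_symm v]
  rfl

theorem norm_analysisMap_le (hf : IsBesselFamily f) (v : K) : ‖hf.analysisMap v‖ ≤ 1 * ‖v‖ := by
  rw [one_mul, ← sq_le_sq₀ (norm_nonneg _) (norm_nonneg _), hf.norm_analysisMap_sq]
  exact hf.toReal_frameEnergy_le v

theorem continuous_toReal_frameEnergy (hf : IsBesselFamily f) :
    Continuous fun v => (frameEnergy f v).toReal := by
  simp only [← hf.norm_analysisMap_sq]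
  exact ((AddMonoidHomClass.continuous_of_bound hf.analysisMap 1 hf.norm_analysisMap_le).norm).pow 2

end IsBesselFamily

theorem norm_map_eq_of_dense_span {L : Type*} [NormedAddCommGroup L]
    [InnerProductSpace ℂ L] [CompleteSpace K] [CompleteSpace L] {Θ : K →L[ℂ] L} (hΘ : ‖Θ‖ ≤ 1)
    {S : Set K} (hS : (Submodule.span ℂ S).topologicalClosure = ⊤) (h : ∀ x ∈ S, ‖Θ x‖ = ‖x‖)
    (x : K) : ‖Θ x‖ = ‖x‖ := by
  have hfix : ∀ x ∈ S, Θ.adjoint (Θ x) = x := fun x hx => by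
    have hinner : RCLike.re ⟪Θ.adjoint (Θ x), x⟫_ℂ = ‖x‖ ^ 2 := by
      rw [ContinuousLinearMap.adjoint_inner_left, inner_self_eq_norm_sq, h x hx]
    have hle : ‖Θ.adjoint (Θ x)‖ ≤ ‖x‖ := by
      calc ‖Θ.adjoint (Θ x)‖ ≤ 1 * ‖Θ x‖ :=
            Θ.adjoint.le_of_opNorm_le (by rwa [LinearIsometryEquiv.norm_map]) _
        _ = ‖x‖ := by rw [one_mul, h x hx]
    have hdist : ‖Θ.adjoint (Θ x) - x‖ ^ 2 ≤ 0 := by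
      rw [norm_sub_sq (𝕜 := ℂ), hinner]
      nlinarith [pow_le_pow_left₀ (norm_nonneg _) hle 2]
    exact sub_eq_zero.1 (norm_eq_zero.1 (sq_nonpos_iff _ |>.1 hdist))
  refine Θ.norm_map_iff_adjoint_comp_self.2 (ContinuousLinearMap.ext_on ?_ hfix) x
  exact Submodule.dense_iff_topologicalClosure_eq_top.2 hS

theorem IsBesselFamily.isParsevalFrame [CompleteSpace K] (hf : IsBesselFamily f) {S : Set K}
    (hS : (Submodule.span ℂ S).topologicalClosure = ⊤)
    (h : ∀ x ∈ S, (frameEnergy f x).toReal = ‖x‖ ^ 2) : IsParsevalFrame f := fun v => by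
  have hnorm := norm_map_eq_of_dense_span
    (Θ := hf.analysisMap.mkContinuous 1 hf.norm_analysisMap_le)
    (LinearMap.mkContinuous_norm_le _ zero_le_one _) hS (fun x hx => by
      rw [← sq_eq_sq₀ (norm_nonneg _) (norm_nonneg _), ← h x hx]
      exact hf.norm_analysisMap_sq x) v
  have hv := hf.hasSum v
  rwa [← hf.norm_analysisMap_sq, show ‖hf.analysisMap v‖ = ‖v‖ from hnorm] at hv

end Frame

theorem tsum_list {α : Type*} (F : List α → ℝ≥0∞) :
    ∑' ω, F ω = F [] + ∑' i, ∑' ω, F (i :: ω) := by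
  let φ : Unit ⊕ α × List α ≃ List α :=
    { toFun := Sum.elim (fun _ => []) fun p => p.1 :: p.2
      invFun := fun ω => match ω with
        | [] => .inl ()
        | i :: ω => .inr (i, ω)
      left_inv := by rintro (_ | _) <;> rfl
      right_inv := by rintro (_ | _) <;> rfl }
  rw [← φ.tsum_eq, ENNReal.summable.tsum_sum ENNReal.summable, ← ENNReal.tsum_prod]
  simp [φ]

namespace IsRowCoisometry

variable {K : Type*} [NormedAddCommGroup K] [InnerProductSpace ℂ K] [CompleteSpace K] {N : ℕ}
  {V : Fin N → K →L[ℂ] K}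

theorem sum_inner (hV : IsRowCoisometry V) (x y : K) :
    ∑ i, ⟪(V i).adjoint x, (V i).adjoint y⟫_ℂ = ⟪x, y⟫_ℂ := by
  have h := congrArg (fun A : K →L[ℂ] K => ⟪x, A y⟫_ℂ) hV.2
  simpa [sum_apply, inner_sum, ContinuousLinearMap.adjoint_inner_left] using h

theorem sum_norm_sq (hV : IsRowCoisometry V) (x : K) : ∑ i, ‖(V i).adjoint x‖ ^ 2 = ‖x‖ ^ 2 := by
  have h := hV.sum_inner x x
  simp only [inner_self_eq_norm_sq_to_K] at h
  exact_mod_cast h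

theorem sum_enorm_sq (hV : IsRowCoisometry V) (x : K) :
    ∑ i, ‖(V i).adjoint x‖ₑ ^ 2 = ‖x‖ₑ ^ 2 := by
  simp only [← ofReal_norm, ← ENNReal.ofReal_pow (norm_nonneg _)]
  rw [← ENNReal.ofReal_sum_of_nonneg fun _ _ => sq_nonneg _, hV.sum_norm_sq]

end IsRowCoisometry

section WordFamily

variable {K : Type*} [NormedAddCommGroup K] [InnerProductSpace ℂ K] {N : ℕ}
  {V : Fin N → K →L[ℂ] K} {ι : Type*} {b : ι → K} {Ω Ω' : ι → Set (List (Fin N))}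

/-- The family `V_ω b_j`, indexed by the pairs `(j, ω)` with `ω ∈ Ω_j`. -/
def wordFamily (V : Fin N → K →L[ℂ] K) (b : ι → K) (Ω : ι → Set (List (Fin N)))
    (a : Σ j, Ω j) : K :=
  wordOp V a.2.1 (b a.1)

theorem frameEnergy_wordFamily (v : K) :
    frameEnergy (wordFamily V b Ω) v =
      ∑' j, ∑' ω, (Ω j).indicator (fun ω => ‖⟪v, wordOp V ω (b j)⟫_ℂ‖ₑ ^ 2) ω := by
  simp_rw [← tsum_subtype]
  exact ENNReal.tsum_sigma' _

theorem frameEnergy_wordFamily_mono (h : ∀ j, Ω j ⊆ Ω' j) (v : K) :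
    frameEnergy (wordFamily V b Ω) v ≤ frameEnergy (wordFamily V b Ω') v := by
  simp_rw [frameEnergy_wordFamily]
  gcongr
  exact h _

theorem frameEnergy_wordFamily_add_diff (h : ∀ j, Ω j ⊆ Ω' j) (v : K) :
    frameEnergy (wordFamily V b Ω) v + frameEnergy (wordFamily V b fun j => Ω' j \ Ω j) v =
      frameEnergy (wordFamily V b Ω') v := by
  simp_rw [frameEnergy_wordFamily, ← ENNReal.tsum_add]
  congr! 4 with j ω
  by_cases hω : ω ∈ Ω j
  · simp [hω, h j hω]
  · by_cases hω' : ω ∈ Ω' j <;> simp [hω, hω']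

variable [CompleteSpace K]

theorem inner_wordOp_cons (v x : K) (i : Fin N) (ω : List (Fin N)) :
    ⟪v, wordOp V (i :: ω) x⟫_ℂ = ⟪(V i).adjoint v, wordOp V ω x⟫_ℂ :=
  ((V i).adjoint_inner_left _ _).symm

theorem frameEnergy_wordFamily_eq_add_sum_cons (hnil : ∀ j, [] ∈ Ω j) (v : K) :
    frameEnergy (wordFamily V b Ω) v =
      frameEnergy b v +
        ∑ i, frameEnergy (wordFamily V b fun j => List.cons i ⁻¹' Ω j) ((V i).adjoint v) := by
  have hcomm : ∑ i, frameEnergy (wordFamily V b fun j => List.cons i ⁻¹' Ω j) ((V i).adjoint v) =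
      ∑' j, ∑' i, ∑' ω,
        (Ω j).indicator (fun ω => ‖⟪v, wordOp V ω (b j)⟫_ℂ‖ₑ ^ 2) (i :: ω) := by
    simp_rw [frameEnergy_wordFamily, ← inner_wordOp_cons]
    rw [← tsum_fintype (L := .unconditional _), ENNReal.tsum_comm]
    rfl
  rw [hcomm, frameEnergy_wordFamily, frameEnergy, ← ENNReal.tsum_add]
  refine tsum_congr fun j => ?_
  rw [tsum_list, Set.indicator_of_mem (hnil j)]
  rfl

/-- The system `(b_j, Ω_j)` is wandering for `(V_i)`: the vectors `b_j` are orthonormal, and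
orthogonal to all `V_ω b_k` for `ω ∈ Ω_k` nonempty, where the sets of words `Ω_k` contain the empty
word and are closed under removing the first letter. -/
structure IsWandering (V : Fin N → K →L[ℂ] K) (b : ι → K) (Ω : ι → Set (List (Fin N))) :
    Prop where
  orthonormal : Orthonormal ℂ b
  nil_mem : ∀ j, [] ∈ Ω j
  mem_of_cons_mem : ∀ {j i ω}, i :: ω ∈ Ω j → ω ∈ Ω j
  inner_eq_zero : ∀ k {j i ω}, i :: ω ∈ Ω j → ⟪b k, wordOp V (i :: ω) (b j)⟫_ℂ = 0

/-- The exit condition for `(b_j, Ω_j)`: if a new first letter takes a word out of `Ω_j`, then the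
operator of the resulting word maps `b_j` to a multiple of itself. For reversing walks and words not
ending in a cycle word, the words so obtained are themselves cycle words. -/
def ReturnsOnExit (V : Fin N → K →L[ℂ] K) (b : ι → K) (Ω : ι → Set (List (Fin N))) : Prop :=
  ∀ j i ω, ω ∈ Ω j → i :: ω ∉ Ω j → ∃ a : ℂ, wordOp V (i :: ω) (b j) = a • b j

namespace IsWandering

theorem exists_orthogonal_part (h : IsWandering V b Ω) (v : K) :
    ∃ w : K, frameEnergy b v + ‖w‖ₑ ^ 2 ≤ ‖v‖ₑ ^ 2 ∧ ∀ {j i ω}, i :: ω ∈ Ω j →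
      ⟪v, wordOp V (i :: ω) (b j)⟫_ℂ = ⟪w, wordOp V (i :: ω) (b j)⟫_ℂ := by
  let U := (Submodule.span ℂ (Set.range b)).topologicalClosure
  have hbU (j : ι) : b j ∈ U :=
    Submodule.le_topologicalClosure _ (Submodule.subset_span (Set.mem_range_self j))
  have horth {j i ω} (hω : i :: ω ∈ Ω j) : wordOp V (i :: ω) (b j) ∈ Uᗮ := by
    rw [Submodule.orthogonal_closure, ← Submodule.span_singleton_le_iff_mem,
      ← Submodule.isOrtho_iff_le, Submodule.isOrtho_comm, Submodule.isOrtho_span]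
    rintro _ ⟨k, rfl⟩ _ rfl
    exact h.inner_eq_zero k hω
  refine ⟨Uᗮ.starProjection v, ?_, fun {j i ω} hω => ?_⟩
  · have henergy : frameEnergy b v = frameEnergy b (U.starProjection v) := by
      refine tsum_congr fun j => ?_
      rw [U.inner_starProjection_left_eq_right, U.starProjection_eq_self_iff.2 (hbU j)]
    have hsq : ‖v‖ₑ ^ 2 = ‖U.starProjection v‖ₑ ^ 2 + ‖Uᗮ.starProjection v‖ₑ ^ 2 := by
      simp only [← ofReal_norm, ← ENNReal.ofReal_pow (norm_nonneg _)]
      rw [← ENNReal.ofReal_add (sq_nonneg _) (sq_nonneg _),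
        ← U.norm_sq_eq_add_norm_sq_starProjection]
    rw [henergy, hsq]
    gcongr
    exact isBesselFamily_of_orthonormal h.orthonormal _
  · rw [Uᗮ.inner_starProjection_left_eq_right, Uᗮ.starProjection_eq_self_iff.2 (horth hω)]

theorem frameEnergy_le_of_cons (h : IsWandering V b Ω) (hV : IsRowCoisometry V)
    (hcons : ∀ i w, frameEnergy (wordFamily V b fun j => List.cons i ⁻¹' Ω j) w ≤ ‖w‖ₑ ^ 2)
    (v : K) : frameEnergy (wordFamily V b Ω) v ≤ ‖v‖ₑ ^ 2 := by
  obtain ⟨w, hw, hinner⟩ := h.exists_orthogonal_part v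
  have hshift (i : Fin N) :
      frameEnergy (wordFamily V b fun j => List.cons i ⁻¹' Ω j) ((V i).adjoint v) =
        frameEnergy (wordFamily V b fun j => List.cons i ⁻¹' Ω j) ((V i).adjoint w) := by
    refine tsum_congr fun a => ?_
    rw [wordFamily, ← inner_wordOp_cons, ← inner_wordOp_cons, hinner a.2.2]
  calc frameEnergy (wordFamily V b Ω) v
      = frameEnergy b v +
          ∑ i, frameEnergy (wordFamily V b fun j => List.cons i ⁻¹' Ω j) ((V i).adjoint w) := by
        rw [frameEnergy_wordFamily_eq_add_sum_cons h.nil_mem]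
        simp only [hshift]
    _ ≤ frameEnergy b v + ∑ i, ‖(V i).adjoint w‖ₑ ^ 2 := by gcongr with i; exact hcons i _
    _ = frameEnergy b v + ‖w‖ₑ ^ 2 := by rw [hV.sum_enorm_sq]
    _ ≤ ‖v‖ₑ ^ 2 := hw

omit [CompleteSpace K] in
theorem truncate (h : IsWandering V b Ω) (n : ℕ) :
    IsWandering V b fun j => {ω ∈ Ω j | ω.length ≤ n} where
  orthonormal := h.orthonormal
  nil_mem j := ⟨h.nil_mem j, n.zero_le⟩
  mem_of_cons_mem hω := ⟨h.mem_of_cons_mem hω.1, (Nat.le_succ _).trans hω.2⟩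
  inner_eq_zero k _ _ _ hω := h.inner_eq_zero k hω.1

theorem frameEnergy_truncate_le (h : IsWandering V b Ω) (hV : IsRowCoisometry V) (n : ℕ) :
    ∀ v, frameEnergy (wordFamily V b fun j => {ω ∈ Ω j | ω.length ≤ n}) v ≤ ‖v‖ₑ ^ 2 := by
  induction n with
  | zero =>
    refine (h.truncate 0).frameEnergy_le_of_cons hV fun i w => ?_
    simp [frameEnergy_wordFamily]
  | succ n ih =>
    refine (h.truncate _).frameEnergy_le_of_cons hV fun i w => le_trans ?_ (ih w)
    have hsub (j : ι) : List.cons i ⁻¹' {ω ∈ Ω j | ω.length ≤ n + 1} ⊆ {ω ∈ Ω j | ω.length ≤ n} :=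
      fun ω hω => ⟨h.mem_of_cons_mem hω.1, Nat.le_of_succ_le_succ hω.2⟩
    exact frameEnergy_wordFamily_mono hsub w

theorem isBesselFamily (h : IsWandering V b Ω) (hV : IsRowCoisometry V) :
    IsBesselFamily (wordFamily V b Ω) := fun v => by
  refine ENNReal.summable.tsum_le_of_sum_le fun s => ?_
  let n := s.sup fun a => a.2.1.length
  let φ (a : s) : Σ j, {ω | ω ∈ Ω j ∧ ω.length ≤ n} :=
    ⟨a.1.1, a.1.2.1, a.1.2.2, Finset.le_sup (f := fun a => a.2.1.length) a.2⟩
  have hφ : φ.Injective := by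
    rintro ⟨⟨j, ω, hω⟩, ha⟩ ⟨⟨j', ω', hω'⟩, ha'⟩ h
    simp only [φ, Sigma.mk.injEq] at h
    obtain ⟨rfl, h⟩ := h
    simpa using h
  rw [← Finset.tsum_subtype]
  exact (ENNReal.tsum_comp_le_tsum_of_injective hφ fun a => ‖⟪v, wordFamily V b _ a⟫_ℂ‖ₑ ^ 2).trans
    (h.frameEnergy_truncate_le hV n v)

theorem frameEnergy_base (h : IsWandering V b Ω) (hV : IsRowCoisometry V) (j : ι) :
    frameEnergy (wordFamily V b Ω) (b j) = 1 := by
  have hb : ‖b j‖ₑ = 1 := by rw [← ofReal_norm, h.orthonormal.1, ENNReal.ofReal_one]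
  refine le_antisymm ((h.isBesselFamily hV _).trans_eq (by rw [hb, one_pow])) ?_
  calc (1 : ℝ≥0∞) = ‖⟪b j, wordFamily V b Ω ⟨j, [], h.nil_mem j⟩⟫_ℂ‖ₑ ^ 2 := by
        rw [show wordFamily V b Ω ⟨j, [], h.nil_mem j⟩ = b j from rfl,
          inner_self_eq_norm_sq_to_K, h.orthonormal.1]
        simp
    _ ≤ frameEnergy (wordFamily V b Ω) (b j) :=
      ENNReal.le_tsum (f := fun a => ‖⟪b j, wordFamily V b Ω a⟫_ℂ‖ₑ ^ 2) _

theorem sum_frameEnergy_loops_le (h : IsWandering V b Ω) (hV : IsRowCoisometry V)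
    (hloop : ReturnsOnExit V b Ω)
    (v : K) :
    ∑ i, frameEnergy (wordFamily V b fun j => Ω j \ List.cons i ⁻¹' Ω j) ((V i).adjoint v) ≤
      frameEnergy b v := by
  have hcoeff (j : ι) : ∑ i, ∑' ω, (Ω j \ List.cons i ⁻¹' Ω j).indicator
      (fun ω => ‖⟪b j, wordOp V (i :: ω) (b j)⟫_ℂ‖ₑ ^ 2) ω ≤ 1 := by
    have hb : ‖b j‖ₑ = 1 := by rw [← ofReal_norm, h.orthonormal.1, ENNReal.ofReal_one]
    calc _ ≤ ∑ i, frameEnergy (wordFamily V b Ω) ((V i).adjoint (b j)) := by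
          gcongr with i
          rw [frameEnergy_wordFamily]
          simp_rw [← inner_wordOp_cons]
          refine le_trans ?_ (ENNReal.le_tsum j)
          gcongr
          exact Set.sdiff_subset
      _ ≤ ∑ i, ‖(V i).adjoint (b j)‖ₑ ^ 2 := by gcongr with i; exact h.isBesselFamily hV _
      _ = 1 := by rw [hV.sum_enorm_sq, hb, one_pow]
  have hterm (i : Fin N) (j : ι) (ω : List (Fin N)) : (Ω j \ List.cons i ⁻¹' Ω j).indicator
        (fun ω => ‖⟪v, wordOp V (i :: ω) (b j)⟫_ℂ‖ₑ ^ 2) ω =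
      ‖⟪v, b j⟫_ℂ‖ₑ ^ 2 * (Ω j \ List.cons i ⁻¹' Ω j).indicator
        (fun ω => ‖⟪b j, wordOp V (i :: ω) (b j)⟫_ℂ‖ₑ ^ 2) ω := by
    rw [← Set.indicator_const_mul]
    refine congrFun (Set.indicator_congr fun ω hω => ?_) ω
    obtain ⟨a, ha⟩ := hloop j i ω hω.1 hω.2
    rw [ha, inner_smul_right, inner_smul_right, inner_self_eq_norm_sq_to_K, h.orthonormal.1]
    simp [mul_pow, mul_comm]
  simp_rw [frameEnergy_wordFamily, ← inner_wordOp_cons, hterm, ENNReal.tsum_mul_left]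
  rw [← tsum_fintype (L := .unconditional _), ENNReal.tsum_comm]
  simp_rw [ENNReal.tsum_mul_left, tsum_fintype]
  refine ENNReal.tsum_le_tsum fun j => mul_le_of_le_one_right' (hcoeff j)

theorem sum_frameEnergy_adjoint_le (h : IsWandering V b Ω) (hV : IsRowCoisometry V)
    (hloop : ReturnsOnExit V b Ω)
    (v : K) :
    ∑ i, frameEnergy (wordFamily V b Ω) ((V i).adjoint v) ≤ frameEnergy (wordFamily V b Ω) v := by
  have hsplit (i : Fin N) := frameEnergy_wordFamily_add_diff (V := V) (b := b)
    (Ω := fun j => List.cons i ⁻¹' Ω j) (fun j _ hω => h.mem_of_cons_mem hω) ((V i).adjoint v)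
  rw [frameEnergy_wordFamily_eq_add_sum_cons h.nil_mem, add_comm,
    ← Finset.sum_congr rfl fun i _ => hsplit i, Finset.sum_add_distrib]
  gcongr
  exact h.sum_frameEnergy_loops_le hV hloop v

end IsWandering

end WordFamily

section Walk

variable {K : Type*} [NormedAddCommGroup K] [InnerProductSpace ℂ K] {N : ℕ}
  {V : Fin N → K →L[ℂ] K} {X : Type*} {e : X → K} {g : Fin N → X → X} {ν : Fin N → X → ℂ}

theorem adjoint_wordOp_apply [CompleteSpace K]
    (he : ∀ i x, (V i).adjoint (e x) = ν i x • e (g i x)) (ω : List (Fin N)) (x : X) :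
    (wordOp V ω).adjoint (e x) = wordWeight g ν ω x • e (wordMap g ω x) := by
  induction ω generalizing x with
  | nil =>
    refine ext_inner_right ℂ fun y => ?_
    simp [wordOp, wordWeight, wordMap, ContinuousLinearMap.adjoint_inner_left]
  | cons i ω ih =>
    rw [wordOp, ContinuousLinearMap.adjoint_comp, ContinuousLinearMap.comp_apply, he, map_smul, ih,
      smul_smul, wordWeight, wordMap]

theorem WalkReversing.wordOp_apply (hrev : WalkReversing V e g ν) {ω : List (Fin N)} {x : X}
    (hω : wordWeight g ν ω x ≠ 0) :
    wordOp V ω (e (wordMap g ω x)) = (starRingEnd ℂ) (wordWeight g ν ω x) • e x := by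
  induction ω generalizing x with
  | nil => simp [wordOp, wordWeight, wordMap]
  | cons i ω ih =>
    obtain ⟨hi, hω⟩ := mul_ne_zero_iff.1 hω
    rw [wordOp, ContinuousLinearMap.comp_apply, wordMap, ih hω, map_smul, hrev i x hi, smul_smul,
      wordWeight, map_mul, mul_comm]

theorem IsCycleWord.wordOp_apply (hrev : WalkReversing V e g ν) {c : X} {β : List (Fin N)}
    (hβ : IsCycleWord g ν c β) :
    wordOp V β (e c) = (starRingEnd ℂ) (wordWeight g ν β c) • e c := by
  simpa only [hβ.2.1] using hrev.wordOp_apply hβ.2.2.2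

theorem exists_cycle_suffix_or_forall_take_ne {c x : X} {ω : List (Fin N)}
    (hmap : wordMap g ω x = c) (hω : wordWeight g ν ω x ≠ 0) :
    (∃ β, IsCycleWord g ν c β ∧ β <:+ ω) ∨ ∀ k < ω.length, wordMap g (ω.take k) x ≠ c := by
  induction ω generalizing x with
  | nil => simp
  | cons i ω ih =>
    obtain ⟨β, hβ, hsuffix⟩ | hne := ih hmap (right_ne_zero_of_mul hω)
    · exact .inl ⟨β, hβ, hsuffix.trans (ω.suffix_cons i)⟩
    have hlater : ∀ k < ω.length, wordMap g ((i :: ω).take (k + 1)) x ≠ c := hne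
    by_cases hx : x = c
    · subst hx
      refine .inl ⟨i :: ω, ⟨List.cons_ne_nil _ _, hmap, fun k hk hlt => ?_, hω⟩, List.suffix_rfl⟩
      obtain ⟨k, rfl⟩ := Nat.exists_eq_add_one.2 hk
      exact hlater k (Nat.lt_of_succ_lt_succ hlt)
    · refine .inr fun k hk => ?_
      cases k with
      | zero => exact hx
      | succ k => exact hlater k (Nat.lt_of_succ_lt_succ hk)

theorem exists_isCycleWord_suffix {c : X} {ω : List (Fin N)} (hne : ω ≠ [])
    (hmap : wordMap g ω c = c) (hω : wordWeight g ν ω c ≠ 0) :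
    ∃ β, IsCycleWord g ν c β ∧ β <:+ ω :=
  (exists_cycle_suffix_or_forall_take_ne hmap hω).resolve_right fun h =>
    h 0 (List.length_pos_iff.2 hne) rfl

theorem nil_mem_wordsNotEndingInCycle (c : X) : [] ∈ wordsNotEndingInCycle g ν c :=
  fun _ hβ hsuffix => hβ.1 (List.suffix_nil.1 hsuffix)

theorem mem_wordsNotEndingInCycle_of_cons {c : X} {i : Fin N} {ω : List (Fin N)}
    (h : i :: ω ∈ wordsNotEndingInCycle g ν c) : ω ∈ wordsNotEndingInCycle g ν c :=
  fun β hβ hsuffix => h β hβ (hsuffix.trans (ω.suffix_cons i))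

theorem isCycleWord_cons {c : X} {i : Fin N} {ω : List (Fin N)}
    (hω : ω ∈ wordsNotEndingInCycle g ν c) (h : i :: ω ∉ wordsNotEndingInCycle g ν c) :
    IsCycleWord g ν c (i :: ω) := by
  simp only [wordsNotEndingInCycle, Set.mem_ofPred_eq, not_forall, not_not] at h
  obtain ⟨β, hβ, hsuffix⟩ := h
  obtain rfl | hsuffix := List.suffix_cons_iff.1 hsuffix
  · exact hβ
  · exact absurd hsuffix (hω β hβ)

end Walk

theorem isWandering_wordsNotEndingInCycle {K : Type*} [NormedAddCommGroup K]
    [InnerProductSpace ℂ K] [CompleteSpace K] {N : ℕ} {V : Fin N → K →L[ℂ] K} {ι : Type*}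
    {X : ι → Type*} {e : ∀ j, X j → K} {g : ∀ j, Fin N → X j → X j} {ν : ∀ j, Fin N → X j → ℂ}
    (horth : Orthonormal ℂ fun p : Σ j, X j => e p.1 p.2)
    (he : ∀ j i x, (V i).adjoint (e j x) = ν j i x • e j (g j i x)) (c : ∀ j, X j) :
    IsWandering V (fun j => e j (c j)) fun j => wordsNotEndingInCycle (g j) (ν j) (c j) where
  orthonormal := horth.comp (fun j => ⟨j, c j⟩) fun _ _ h => congrArg Sigma.fst h
  nil_mem j := nil_mem_wordsNotEndingInCycle (c j)
  mem_of_cons_mem := mem_wordsNotEndingInCycle_of_cons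
  inner_eq_zero k j i ω hω := by
    rw [← ContinuousLinearMap.adjoint_inner_left, adjoint_wordOp_apply (he k), inner_smul_left]
    by_cases hweight : wordWeight (g k) (ν k) (i :: ω) (c k) = 0
    · rw [hweight, map_zero, zero_mul]
    have hne : (⟨k, wordMap (g k) (i :: ω) (c k)⟩ : Σ j, X j) ≠ ⟨j, c j⟩ := fun h => by
      obtain rfl : k = j := congrArg Sigma.fst h
      obtain ⟨β, hβ, hsuffix⟩ :=
        exists_isCycleWord_suffix (List.cons_ne_nil i ω) (by simpa using h) hweight
      exact hω β hβ hsuffix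
    rw [horth.2 hne, mul_zero]

section Contractions

open TopologicalSpace

variable {T : Type*} [MetricSpace T] {ι : Type*} {g : ι → T → T} {κ : NNReal}

theorem exists_uniform_lipschitzWith [Finite ι] (hg : ∀ i, ∃ κ, ContractingWith κ (g i)) :
    ∃ κ : NNReal, κ < 1 ∧ ∀ i, LipschitzWith κ (g i) := by
  have := Fintype.ofFinite ι
  choose κ hκ using hg
  exact ⟨Finset.univ.sup κ, (Finset.sup_lt_iff one_pos).2 fun i _ => (hκ i).1,
    fun i => (hκ i).2.weaken (Finset.le_sup (Finset.mem_univ i))⟩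

/-- The Hutchinson operator `S ↦ {t} ∪ ⋃ i, g_i(S)` with condensation point `t`, on nonempty compact
sets. Its fixed points are stable under all `g_i` and contain `t`. -/
def hutchinson [Finite ι] (hg : ∀ i, LipschitzWith κ (g i)) (t : T) (S : NonemptyCompacts T) :
    NonemptyCompacts T where
  carrier := {t} ∪ ⋃ i, g i '' S
  isCompact' := isCompact_singleton.union <|
    isCompact_iUnion fun i => S.isCompact.image (hg i).continuous
  nonempty' := ⟨t, .inl rfl⟩

theorem lipschitzWith_hutchinson [Finite ι] (hg : ∀ i, LipschitzWith κ (g i)) (t : T) :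
    LipschitzWith κ (hutchinson hg t) := by
  have hclose (A B : NonemptyCompacts T) : ∀ x ∈ (hutchinson hg t A : Set T),
      ∃ y ∈ (hutchinson hg t B : Set T), edist x y ≤ κ * edist A B := by
    rintro x (rfl | hx)
    · exact ⟨x, .inl rfl, by simp⟩
    obtain ⟨i, a, ha, rfl⟩ := Set.mem_iUnion.1 hx
    obtain ⟨b, hb, hab⟩ := B.isCompact.exists_infEDist_eq_edist B.nonempty a
    refine ⟨g i b, .inr (Set.mem_iUnion.2 ⟨i, b, hb, rfl⟩), (hg i a b).trans ?_⟩
    gcongr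
    exact hab.symm.trans_le (Metric.infEDist_le_hausdorffEDist_of_mem ha)
  exact fun A B => Metric.hausdorffEDist_le_of_mem_edist (hclose A B) (edist_comm A B ▸ hclose B A)

theorem exists_isCompact_mapsTo_of_lipschitzWith [Finite ι] [CompleteSpace T] (hκ : κ < 1)
    (hg : ∀ i, LipschitzWith κ (g i)) (t : T) :
    ∃ Z : Set T, IsCompact Z ∧ t ∈ Z ∧ ∀ i, Set.MapsTo (g i) Z Z := by
  have : Nonempty (NonemptyCompacts T) := ⟨{t}⟩
  have hF : ContractingWith κ (hutchinson hg t) := ⟨hκ, lipschitzWith_hutchinson hg t⟩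
  have hfix : {t} ∪ ⋃ i, g i '' (hF.fixedPoint : Set T) = hF.fixedPoint :=
    congrArg SetLike.coe hF.fixedPoint_isFixedPt
  refine ⟨hF.fixedPoint, hF.fixedPoint.isCompact, hfix ▸ .inl rfl, fun i x hx => ?_⟩
  exact hfix ▸ .inr (Set.mem_iUnion.2 ⟨i, x, hx, rfl⟩)

theorem subset_of_subset_iUnion_image (hκ : κ < 1) (hg : ∀ i, LipschitzWith κ (g i))
    {Z M : Set T} (hZ : IsCompact Z) (hZne : Z.Nonempty) (hmaps : ∀ i, Set.MapsTo (g i) Z Z)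
    (hM : IsCompact M) (hsub : M ⊆ ⋃ i, g i '' M) : M ⊆ Z := by
  intro y hy
  obtain ⟨x, hx, hmax⟩ :=
    hM.exists_isMaxOn ⟨y, hy⟩ (Metric.continuous_infDist_pt Z).continuousOn
  obtain ⟨i, x', hx', rfl⟩ := Set.mem_iUnion.1 (hsub hx)
  obtain ⟨z, hz, hdist⟩ := hZ.exists_infDist_eq_dist hZne x'
  have hcontract : Metric.infDist (g i x') Z ≤ κ * Metric.infDist (g i x') Z :=
    calc Metric.infDist (g i x') Z ≤ dist (g i x') (g i z) :=
          Metric.infDist_le_dist_of_mem (hmaps i hz)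
      _ ≤ κ * dist x' z := (hg i).dist_le_mul _ _
      _ ≤ κ * Metric.infDist (g i x') Z := by
          rw [← hdist]
          gcongr
          exact hmax hx'
  have hzero : Metric.infDist (g i x') Z ≤ 0 := by
    have : (κ : ℝ) < 1 := hκ
    nlinarith
  rw [hZ.isClosed.mem_iff_infDist_zero hZne]
  exact le_antisymm ((hmax hy).trans hzero) Metric.infDist_nonneg

end Contractions

section InvariantSets

variable {T : Type*} {N : ℕ} {g : Fin N → T → T} {ν : Fin N → T → ℂ} {M A B : Set T}

namespace IsInvariantSet

theorem inter (hA : IsInvariantSet g ν A) (hB : IsInvariantSet g ν B) :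
    IsInvariantSet g ν (A ∩ B) :=
  fun t ht i hi => ⟨hA t ht.1 i hi, hB t ht.2 i hi⟩

theorem union (hA : IsInvariantSet g ν A) (hB : IsInvariantSet g ν B) :
    IsInvariantSet g ν (A ∪ B) :=
  fun t ht i hi => ht.imp (hA t · i hi) (hB t · i hi)

theorem sInter {𝒜 : Set (Set T)} (h : ∀ A ∈ 𝒜, IsInvariantSet g ν A) :
    IsInvariantSet g ν (⋂₀ 𝒜) :=
  fun t ht i hi A hA => h A hA t (ht A hA) i hi

theorem coe_restrictMaps (hM : IsInvariantSet g ν M) {i : Fin N} {c : M} (h : ν i c ≠ 0) :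
    (restrictMaps g M i c : T) = g i c := by
  rw [restrictMaps, dif_pos (hM c c.2 i h)]

theorem wordWeight_restrict (hM : IsInvariantSet g ν M) (ω : List (Fin N)) (c : M) :
    wordWeight (restrictMaps g M) (restrictWeights ν M) ω c = wordWeight g ν ω c := by
  induction ω generalizing c with
  | nil => rfl
  | cons i ω ih =>
    by_cases h : ν i c = 0
    · simp [wordWeight, restrictWeights, h]
    · simp [wordWeight, ih, hM.coe_restrictMaps h, restrictWeights]

end IsInvariantSet

end InvariantSets

section MinimalSets

variable {T : Type*} [TopologicalSpace T] {N : ℕ} {g : Fin N → T → T}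
  {ν : Fin N → T → ℂ} {M M' Y : Set T}

theorem exists_isMinimalCompactInvariant [T2Space T] (hne : Y.Nonempty) (hY : IsCompact Y)
    (hinv : IsInvariantSet g ν Y) : ∃ M ⊆ Y, IsMinimalCompactInvariant g ν M := by
  refine zorn_superset_nonempty {A : Set T | A.Nonempty ∧ IsCompact A ∧ IsInvariantSet g ν A}
    (fun 𝒜 h𝒜 hchain hne𝒜 => ?_) Y ⟨hne, hY, hinv⟩
  have hclosed : ∀ A ∈ 𝒜, IsClosed A := fun A hA => (h𝒜 hA).2.1.isClosed
  obtain ⟨A₀, hA₀⟩ := hne𝒜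
  have : Nonempty 𝒜 := ⟨⟨A₀, hA₀⟩⟩
  refine ⟨⋂₀ 𝒜, ⟨?_, ?_, .sInter fun A hA => (h𝒜 hA).2.2⟩, fun A => Set.sInter_subset_of_mem⟩
  · exact IsCompact.nonempty_sInter_of_directed_nonempty_isCompact_isClosed
      (fun A hA B hB => (hchain.total hA hB).elim (fun h => ⟨A, hA, subset_rfl, h⟩)
        fun h => ⟨B, hB, h, subset_rfl⟩)
      (fun A hA => (h𝒜 hA).1) (fun A hA => (h𝒜 hA).2.1) hclosed
  · exact (h𝒜 hA₀).2.1.of_isClosed_subset (isClosed_sInter hclosed)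
      (Set.sInter_subset_of_mem hA₀)

namespace IsMinimalCompactInvariant

theorem subset_of_isInvariantSet (hM : IsMinimalCompactInvariant g ν M) (hY : IsClosed Y)
    (hinv : IsInvariantSet g ν Y) (hne : (M ∩ Y).Nonempty) : M ⊆ Y :=
  (hM.le_of_le ⟨hne, hM.prop.2.1.inter_right hY, hM.prop.2.2.inter hinv⟩
    Set.inter_subset_left).trans Set.inter_subset_right

theorem eq_of_mem [T2Space T] (hM : IsMinimalCompactInvariant g ν M)
    (hM' : IsMinimalCompactInvariant g ν M') {t : T} (ht : t ∈ M) (ht' : t ∈ M') : M = M' :=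
  (hM.subset_of_isInvariantSet hM'.prop.2.1.isClosed hM'.prop.2.2 ⟨t, ht, ht'⟩).antisymm
    (hM'.subset_of_isInvariantSet hM.prop.2.1.isClosed hM.prop.2.2 ⟨t, ht', ht⟩)

theorem subset_iUnion_image [T2Space T] (hM : IsMinimalCompactInvariant g ν M)
    (hg : ∀ i, Continuous (g i)) (hν : ∀ t, ∃ i, ν i t ≠ 0) : M ⊆ ⋃ i, g i '' M := by
  have hmem (t : T) (ht : t ∈ M) (i : Fin N) : g i t ∈ ⋃ i, g i '' M :=
    Set.mem_iUnion.2 ⟨i, t, ht, rfl⟩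
  have hcompact : IsCompact (⋃ i, g i '' M) :=
    isCompact_iUnion fun i => hM.prop.2.1.image (hg i)
  obtain ⟨t, ht⟩ := hM.prop.1
  obtain ⟨i, hi⟩ := hν t
  have hinv : IsInvariantSet g ν (M ∩ ⋃ i, g i '' M) :=
    fun x hx j hj => ⟨hM.prop.2.2 x hx.1 j hj, hmem x hx.1 j⟩
  exact (hM.subset_of_isInvariantSet (hM.prop.2.1.isClosed.inter hcompact.isClosed) hinv
    ⟨_, hM.prop.2.2 t ht i hi, hM.prop.2.2 t ht i hi, hmem t ht i⟩).trans Set.inter_subset_right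

theorem walkIrreducible [T1Space T] (hM : IsMinimalCompactInvariant g ν M) (hfin : M.Finite) :
    WalkIrreducible (restrictMaps g M) (restrictWeights ν M) := by
  by_contra h
  simp only [WalkIrreducible, not_forall] at h
  obtain ⟨c, c', hc⟩ := h
  let Y : Set T := Subtype.val '' {x : M | ¬∃ ω, wordMap (restrictMaps g M) ω x = c' ∧
    wordWeight (restrictMaps g M) (restrictWeights ν M) ω x ≠ 0}
  have hYfin : Y.Finite := hfin.subset (Subtype.coe_image_subset _ _)
  have hinv : IsInvariantSet g ν Y := by
    rintro _ ⟨x, hx, rfl⟩ i hi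
    refine ⟨restrictMaps g M i x, fun ⟨ω, hmap, hω⟩ => hx ⟨i :: ω, hmap, mul_ne_zero hi hω⟩,
      hM.prop.2.2.coe_restrictMaps hi⟩
  obtain ⟨x, hx, hxc⟩ := hM.subset_of_isInvariantSet hYfin.isClosed hinv ⟨c, c.2, c, hc, rfl⟩ c'.2
  exact hx ⟨[], Subtype.ext hxc, one_ne_zero⟩

end IsMinimalCompactInvariant

theorem exists_isMinimalCompactInvariant_isMinOn [T2Space T] {p : T → ℝ} (hp : Continuous p)
    (hν : ∀ t, ∑ i, ‖ν i t‖ ^ 2 = 1) (hsuper : ∀ t, ∑ i, ‖ν i t‖ ^ 2 * p (g i t) ≤ p t)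
    (hne : Y.Nonempty) (hY : IsCompact Y) (hinv : IsInvariantSet g ν Y) :
    ∃ M ⊆ Y, IsMinimalCompactInvariant g ν M ∧ ∀ c ∈ M, IsMinOn p Y c := by
  obtain ⟨m, hm, hmin⟩ := hY.exists_isMinOn hne hp.continuousOn
  rw [isMinOn_iff] at hmin
  have hinv' : IsInvariantSet g ν (Y ∩ p ⁻¹' Set.Iic (p m)) := by
    rintro t ⟨htY, htp⟩ i hi
    refine ⟨hinv t htY i hi, ?_⟩
    have hterm (j : Fin N) : ‖ν j t‖ ^ 2 * p m ≤ ‖ν j t‖ ^ 2 * p (g j t) := by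
      by_cases hj : ν j t = 0
      · simp [hj]
      · exact mul_le_mul_of_nonneg_left (hmin _ (hinv t htY j hj)) (sq_nonneg _)
    have hsum : ∑ j, ‖ν j t‖ ^ 2 * p (g j t) = ∑ j, ‖ν j t‖ ^ 2 * p m := by
      refine le_antisymm ?_ (Finset.sum_le_sum fun j _ => hterm j)
      rw [← Finset.sum_mul, hν, one_mul]
      exact (hsuper t).trans htp
    have heq := (Finset.sum_eq_sum_iff_of_le fun j _ => hterm j).1 hsum.symm i (Finset.mem_univ i)
    exact (mul_left_cancel₀ (by positivity) heq).ge
  have hm' : m ∈ Y ∩ p ⁻¹' Set.Iic (p m) := ⟨hm, le_refl (p m)⟩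
  obtain ⟨M, hMsub, hM⟩ := exists_isMinimalCompactInvariant ⟨m, hm'⟩
    (hY.inter_right (isClosed_Iic.preimage hp)) hinv'
  exact ⟨M, fun t ht => (hMsub ht).1, hM, fun c hc =>
    isMinOn_iff.2 fun y hy => (hMsub hc).2.trans (hmin y hy)⟩

end MinimalSets

section Separation

variable {T : Type*} [MetricSpace T] {N : ℕ} {g : Fin N → T → T} {ν : Fin N → T → ℂ} {F : Set T}
  {κ : NNReal}

namespace IsInvariantSet

theorem infsep_le (hF : IsInvariantSet g ν F) (hg : ∀ i, LipschitzWith κ (g i))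
    (hinj : ∀ i, (F ∩ Function.support (ν i)).InjOn (g i)) {ω : List (Fin N)} {c c' : T}
    (hc : c ∈ F) (hc' : c' ∈ F) (hne : c ≠ c') (hω : wordWeight g ν ω c ≠ 0)
    (hω' : wordWeight g ν ω c' ≠ 0) : F.infsep ≤ κ ^ ω.length * dist c c' := by
  induction ω generalizing c c' with
  | nil => simpa using Set.infsep_le_dist_of_mem hc hc' hne
  | cons i ω ih =>
    obtain ⟨hi, hω⟩ := mul_ne_zero_iff.1 hω
    obtain ⟨hi', hω'⟩ := mul_ne_zero_iff.1 hω'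
    have hgne : g i c ≠ g i c' := fun h => hne (hinj i ⟨hc, hi⟩ ⟨hc', hi'⟩ h)
    calc F.infsep ≤ κ ^ ω.length * dist (g i c) (g i c') :=
          ih (hF c hc i hi) (hF c' hc' i hi') hgne hω hω'
      _ ≤ κ ^ ω.length * (κ * dist c c') := by gcongr; exact (hg i).dist_le_mul c c'
      _ = κ ^ (i :: ω).length * dist c c' := by rw [List.length_cons, pow_succ, mul_assoc]

theorem exists_forall_wordWeight_eq_zero (hF : IsInvariantSet g ν F) (hfin : F.Finite)
    (hκ : κ < 1) (hg : ∀ i, LipschitzWith κ (g i))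
    (hinj : ∀ i, (F ∩ Function.support (ν i)).InjOn (g i)) {c c' : T} (hc : c ∈ F) (hc' : c' ∈ F)
    (hne : c ≠ c') : ∃ n : ℕ, ∀ ω : List (Fin N), n ≤ ω.length →
      wordWeight g ν ω c = 0 ∨ wordWeight g ν ω c' = 0 := by
  have hpos : 0 < F.infsep := hfin.infsep_pos_iff_nontrivial.2 ⟨c, hc, c', hc', hne⟩
  have hdist : 0 < dist c c' := dist_pos.2 hne
  obtain ⟨n, hn⟩ := exists_pow_lt_of_lt_one (div_pos hpos hdist) (NNReal.coe_lt_one.2 hκ)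
  refine ⟨n, fun ω hω => ?_⟩
  by_contra! h
  have hsmall : (κ : ℝ) ^ ω.length * dist c c' < F.infsep :=
    (lt_div_iff₀ hdist).1 ((pow_le_pow_of_le_one κ.2 hκ.le hω).trans_lt hn)
  exact hsmall.not_ge (hF.infsep_le hg hinj hc hc' hne h.1 h.2)

end IsInvariantSet

end Separation

section Orthogonality

variable {K : Type*} [NormedAddCommGroup K] [InnerProductSpace ℂ K]

theorem IsRowCoisometry.inner_eq_zero_of_separated [CompleteSpace K] {N : ℕ}
    {V : Fin N → K →L[ℂ] K} (hV : IsRowCoisometry V) {X : Type*} {e : X → K} {g : Fin N → X → X}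
    {ν : Fin N → X → ℂ} (he : ∀ i x, (V i).adjoint (e x) = ν i x • e (g i x)) (n : ℕ) {x y : X}
    (h : ∀ ω : List (Fin N), n ≤ ω.length → wordWeight g ν ω x = 0 ∨ wordWeight g ν ω y = 0) :
    ⟪e x, e y⟫_ℂ = 0 := by
  induction n generalizing x y with
  | zero => simpa [wordWeight] using h [] le_rfl
  | succ n ih =>
    rw [← hV.sum_inner]
    refine Finset.sum_eq_zero fun i _ => ?_
    rw [he, he, inner_smul_left, inner_smul_right]
    by_cases hx : ν i x = 0
    · simp [hx]
    by_cases hy : ν i y = 0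
    · simp [hy]
    · rw [ih fun ω hω => by simpa [wordWeight, hx, hy] using h (i :: ω) (Nat.succ_le_succ hω),
        mul_zero, mul_zero]

theorem finite_of_orthonormal_of_totallyBounded {ι : Type*} {b : ι → K} (hb : Orthonormal ℂ b)
    {S : Set K} (hS : TotallyBounded S) (hbS : ∀ j, b j ∈ S) : Finite ι := by
  obtain ⟨C, hC, hcover⟩ := Metric.totallyBounded_iff.1 hS (1 / 2) (by norm_num)
  have hcentre (j : ι) : ∃ y ∈ C, dist (b j) y < 1 / 2 := by simpa using hcover (hbS j)
  choose y hyC hy using hcentre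
  have := hC.to_subtype
  refine Finite.of_injective (fun j => (⟨y j, hyC j⟩ : C)) fun j k hjk => ?_
  by_contra hne
  have hfar : ‖b j - b k‖ ^ 2 = 2 := by
    rw [norm_sub_sq (𝕜 := ℂ), hb.2 hne, hb.1, hb.1]
    norm_num
  have hclose : ‖b j - b k‖ < 1 := by
    have hk : dist (b k) (y j) < 1 / 2 := (Subtype.mk.inj hjk).symm ▸ hy k
    rw [← dist_eq_norm]
    linarith [dist_triangle_right (b j) (b k) (y j), hy j]
  nlinarith [norm_nonneg (b j - b k)]

end Orthogonality

namespace CoisometryAssumptions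

variable {K : Type*} [NormedAddCommGroup K] [InnerProductSpace ℂ K] [CompleteSpace K]
  {T : Type*} [MetricSpace T] [CompleteSpace T] {N : ℕ} {V : Fin N → K →L[ℂ] K} {e : T → K}
  {g : Fin N → T → T} {ν : Fin N → T → ℂ}

theorem sum_norm_sq (hV : CoisometryAssumptions V e g ν) (t : T) : ∑ i, ‖ν i t‖ ^ 2 = 1 := by
  have h := hV.coisometry.sum_norm_sq (e t)
  simpa only [hV.adjoint_apply, norm_smul, hV.norm_eq_one, mul_one, one_pow] using h

theorem exists_ne_zero (hV : CoisometryAssumptions V e g ν) (t : T) : ∃ i, ν i t ≠ 0 := by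
  by_contra! h
  simpa [h] using hV.sum_norm_sq t

theorem exists_isCompact_mapsTo (hV : CoisometryAssumptions V e g ν) (t : T) :
    ∃ Z : Set T, IsCompact Z ∧ t ∈ Z ∧ ∀ i, Set.MapsTo (g i) Z Z := by
  obtain ⟨κ, hκ, hg⟩ := exists_uniform_lipschitzWith hV.contraction
  exact exists_isCompact_mapsTo_of_lipschitzWith hκ hg t

theorem exists_isCompact_of_minimal (hV : CoisometryAssumptions V e g ν) :
    ∃ Z : Set T, IsCompact Z ∧ ∀ M, IsMinimalCompactInvariant g ν M → M ⊆ Z := by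
  obtain ⟨κ, hκ, hg⟩ := exists_uniform_lipschitzWith hV.contraction
  rcases isEmpty_or_nonempty T with _ | ⟨⟨t⟩⟩
  · exact ⟨∅, isCompact_empty, fun M _ => (Set.eq_empty_of_isEmpty M).subset⟩
  obtain ⟨Z, hZ, ht, hmaps⟩ := hV.exists_isCompact_mapsTo t
  exact ⟨Z, hZ, fun M hM => subset_of_subset_iUnion_image hκ hg hZ ⟨t, ht⟩ hmaps hM.prop.2.1
    (hM.subset_iUnion_image (fun i => (hg i).continuous) hV.exists_ne_zero)⟩

theorem walkSeparating (hV : CoisometryAssumptions V e g ν) {F : Set T}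
    (hF : IsInvariantSet g ν F) (hfin : F.Finite)
    (hinj : ∀ i, (F ∩ Function.support (ν i)).InjOn (g i)) :
    WalkSeparating (restrictMaps g F) (restrictWeights ν F) := by
  intro c c' hne
  simp_rw [hF.wordWeight_restrict]
  obtain ⟨κ, hκ, hg⟩ := exists_uniform_lipschitzWith hV.contraction
  exact hF.exists_forall_wordWeight_eq_zero hfin hκ hg hinj c.2 c'.2 (Subtype.coe_ne_coe.2 hne)

theorem inner_eq_zero (hV : CoisometryAssumptions V e g ν) {F : Set T} (hF : IsInvariantSet g ν F)
    (hfin : F.Finite) (hinj : ∀ i, (F ∩ Function.support (ν i)).InjOn (g i)) {c c' : T}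
    (hc : c ∈ F) (hc' : c' ∈ F) (hne : c ≠ c') : ⟪e c, e c'⟫_ℂ = 0 := by
  obtain ⟨κ, hκ, hg⟩ := exists_uniform_lipschitzWith hV.contraction
  obtain ⟨n, hn⟩ := hF.exists_forall_wordWeight_eq_zero hfin hκ hg hinj hc hc' hne
  exact hV.coisometry.inner_eq_zero_of_separated hV.adjoint_apply n hn

theorem adjoint_mem_spanOn (hV : CoisometryAssumptions V e g ν) {M : Set T}
    (hM : IsInvariantSet g ν M) (i : Fin N) {x : K} (hx : x ∈ spanOn e M) :
    (V i).adjoint x ∈ spanOn e M := by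
  have hle : Submodule.span ℂ (e '' M) ≤
      (Submodule.span ℂ (e '' M)).comap ((V i).adjoint : K →ₗ[ℂ] K) := by
    refine Submodule.span_le.2 ?_
    rintro _ ⟨t, ht, rfl⟩
    change (V i).adjoint (e t) ∈ Submodule.span ℂ (e '' M)
    rw [hV.adjoint_apply]
    by_cases hi : ν i t = 0
    · simp [hi]
    · exact Submodule.smul_mem _ _ (Submodule.subset_span ⟨_, hM t ht i hi, rfl⟩)
  exact map_mem_closure (V i).adjoint.continuous hx hle

theorem adjoint_apply_restrict (hV : CoisometryAssumptions V e g ν) {M : Set T}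
    (hM : IsInvariantSet g ν M) (i : Fin N) (c : M) :
    (V i).adjoint (e c) = restrictWeights ν M i c • e (restrictMaps g M i c) := by
  rw [hV.adjoint_apply, restrictWeights]
  by_cases hi : ν i c = 0
  · simp [hi]
  · rw [hM.coe_restrictMaps hi]

section Minimal

variable (hV : CoisometryAssumptions V e g ν)
  (hg : ∀ M, IsMinimalCompactInvariant g ν M → ∀ i, (M ∩ Function.support (ν i)).InjOn (g i))
  (hfin : ∀ M : Set T, IsMinimalCompactInvariant g ν M → M.Finite)

include hV hg hfin

theorem orthonormal_minimal :
    Orthonormal ℂ fun p : Σ M : {M : Set T // IsMinimalCompactInvariant g ν M}, M.1 =>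
      e p.2 := by
  refine ⟨fun p => hV.norm_eq_one _, ?_⟩
  rintro ⟨⟨M, hM⟩, c, hc⟩ ⟨⟨M', hM'⟩, c', hc'⟩ hne
  refine hV.inner_eq_zero (hM.prop.2.2.union hM'.prop.2.2) ((hfin M hM).union (hfin M' hM'))
    (fun i => ?_) (.inl hc) (.inr hc') ?_
  · have hcross {L L' : Set T} (hL : IsMinimalCompactInvariant g ν L)
        (hL' : IsMinimalCompactInvariant g ν L') {x y : T} (hx : x ∈ L) (hy : y ∈ L')
        (hix : ν i x ≠ 0) (hiy : ν i y ≠ 0) (h : g i x = g i y) : x = y := by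
      obtain rfl : L = L' :=
        hL.eq_of_mem hL' (hL.prop.2.2 x hx i hix) (h ▸ hL'.prop.2.2 y hy i hiy)
      exact hg L hL i ⟨hx, hix⟩ ⟨hy, hiy⟩ h
    rintro x ⟨hx | hx, hix⟩ y ⟨hy | hy, hiy⟩ h
    exacts [hcross hM hM hx hy hix hiy h, hcross hM hM' hx hy hix hiy h,
      hcross hM' hM hx hy hix hiy h, hcross hM' hM' hx hy hix hiy h]
  · rintro rfl
    obtain rfl := hM.eq_of_mem hM' hc hc'
    exact hne rfl

theorem finite_minimal : {M : Set T | IsMinimalCompactInvariant g ν M}.Finite := by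
  obtain ⟨Z, hZ, hsub⟩ := hV.exists_isCompact_of_minimal
  choose c hc using fun M : {M // IsMinimalCompactInvariant g ν M} => M.2.prop.1
  have horth : Orthonormal ℂ fun M => e (c M) :=
    (hV.orthonormal_minimal hg hfin).comp (fun M => ⟨M, c M, hc M⟩) fun _ _ => congrArg Sigma.fst
  exact finite_of_orthonormal_of_totallyBounded horth (hZ.image hV.continuous).totallyBounded
    fun M => ⟨c M, hsub M M.2 (hc M), rfl⟩

theorem isWandering_minimal (c : ∀ M : {M : Set T // IsMinimalCompactInvariant g ν M}, M.1) :
    IsWandering V (fun M => e (c M)) fun M =>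
      wordsNotEndingInCycle (restrictMaps g M.1) (restrictWeights ν M.1) (c M) :=
  isWandering_wordsNotEndingInCycle
    (X := fun M : {M : Set T // IsMinimalCompactInvariant g ν M} => M.1) (e := fun _ t => e t)
    (hV.orthonormal_minimal hg hfin) (fun M => hV.adjoint_apply_restrict M.2.prop.2.2) c

theorem actsAsRandomWalk {M : Set T} (hM : IsMinimalCompactInvariant g ν M) :
    ActsAsRandomWalk V (spanOn e M) (fun t : M => e t) (restrictMaps g M)
      (restrictWeights ν M) where
  closed := Submodule.isClosed_topologicalClosure _
  invariant i _ hx := hV.adjoint_mem_spanOn hM.prop.2.2 i hx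
  finite := hfin M hM
  orthonormal := (hV.orthonormal_minimal hg hfin).comp (fun c : M => ⟨⟨M, hM⟩, c⟩)
    fun _ _ h => eq_of_heq (Sigma.mk.inj h).2
  span_eq := by rw [spanOn, Set.image_eq_range]
  adjoint_apply := hV.adjoint_apply_restrict hM.prop.2.2
  inj i c₁ c₂ h₁ h₂ h := by
    rw [← Subtype.coe_inj, hM.prop.2.2.coe_restrictMaps h₁, hM.prop.2.2.coe_restrictMaps h₂] at h
    exact Subtype.ext (hg M hM i ⟨c₁.2, h₁⟩ ⟨c₂.2, h₂⟩ h)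

end Minimal

section Parseval

variable {ι : Type*} {b : ι → K} {Ω : ι → Set (List (Fin N))}

theorem sum_weight_mul_frameEnergy_le (hV : CoisometryAssumptions V e g ν)
    (h : IsWandering V b Ω)
    (hloop : ReturnsOnExit V b Ω)
    (t : T) :
    ∑ i, ‖ν i t‖ ^ 2 * (frameEnergy (wordFamily V b Ω) (e (g i t))).toReal ≤
      (frameEnergy (wordFamily V b Ω) (e t)).toReal := by
  have hfinite (v : K) : frameEnergy (wordFamily V b Ω) v ≠ ∞ :=
    ((h.isBesselFamily hV.coisometry v).trans_lt (by finiteness)).ne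
  have hsum := ENNReal.toReal_mono (hfinite _)
    (h.sum_frameEnergy_adjoint_le hV.coisometry hloop (e t))
  rw [ENNReal.toReal_sum fun i _ => hfinite _] at hsum
  simpa only [hV.adjoint_apply, frameEnergy_smul, ENNReal.toReal_mul, ENNReal.toReal_pow,
    toReal_enorm] using hsum

theorem frameEnergy_eq_one (hV : CoisometryAssumptions V e g ν) (h : IsWandering V b Ω)
    (hloop : ReturnsOnExit V b Ω)
    (hbase : ∀ M, IsMinimalCompactInvariant g ν M → ∃ c ∈ M, ∃ j, b j = e c) (t : T) :
    (frameEnergy (wordFamily V b Ω) (e t)).toReal = 1 := by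
  have hbessel := h.isBesselFamily hV.coisometry
  obtain ⟨Z, hZ, ht, hmaps⟩ := hV.exists_isCompact_mapsTo t
  obtain ⟨M, -, hM, hmin⟩ := exists_isMinimalCompactInvariant_isMinOn
    (hbessel.continuous_toReal_frameEnergy.comp hV.continuous) hV.sum_norm_sq
    (hV.sum_weight_mul_frameEnergy_le h hloop) ⟨t, ht⟩ hZ fun s hs i _ => hmaps i hs
  obtain ⟨c, hc, j, hj⟩ := hbase M hM
  refine le_antisymm ?_ ?_
  · simpa [hV.norm_eq_one] using hbessel.toReal_frameEnergy_le (e t)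
  · calc 1 = (frameEnergy (wordFamily V b Ω) (e c)).toReal := by
          rw [← hj, h.frameEnergy_base hV.coisometry, ENNReal.toReal_one]
      _ ≤ _ := isMinOn_iff.1 (hmin c hc) t ht

theorem isParsevalFrame (hV : CoisometryAssumptions V e g ν) (h : IsWandering V b Ω)
    (hloop : ReturnsOnExit V b Ω)
    (hbase : ∀ M, IsMinimalCompactInvariant g ν M → ∃ c ∈ M, ∃ j, b j = e c) :
    IsParsevalFrame (wordFamily V b Ω) := by
  refine (h.isBesselFamily hV.coisometry).isParsevalFrame hV.dense_span ?_
  rintro _ ⟨t, rfl⟩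
  rw [hV.frameEnergy_eq_one h hloop hbase, hV.norm_eq_one, one_pow]

theorem isParsevalFrame_minimal (hV : CoisometryAssumptions V e g ν)
    (hg : ∀ M, IsMinimalCompactInvariant g ν M → ∀ i, (M ∩ Function.support (ν i)).InjOn (g i))
    (hfin : ∀ M : Set T, IsMinimalCompactInvariant g ν M → M.Finite)
    (hrev : ∀ M : Set T, IsMinimalCompactInvariant g ν M →
      WalkReversing V (fun t : M => e t) (restrictMaps g M) (restrictWeights ν M))
    (c : ∀ M : {M : Set T // IsMinimalCompactInvariant g ν M}, M.1) :
    IsParsevalFrame (wordFamily V (fun M => e (c M)) fun M =>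
      wordsNotEndingInCycle (restrictMaps g M.1) (restrictWeights ν M.1) (c M)) := by
  refine hV.isParsevalFrame (hV.isWandering_minimal hg hfin c) (fun M i ω hω hi => ?_)
    fun M hM => ⟨c ⟨M, hM⟩, (c ⟨M, hM⟩).2, ⟨M, hM⟩, rfl⟩
  exact ⟨_, (isCycleWord_cons hω hi).wordOp_apply (hrev M.1 M.2)⟩

end Parseval

end CoisometryAssumptions

theorem theorem2p11_general {K : Type*} [NormedAddCommGroup K] [InnerProductSpace ℂ K]
    [CompleteSpace K] {T : Type*} [MetricSpace T] [CompleteSpace T] {N : ℕ}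
    (V : Fin N → K →L[ℂ] K) (e : T → K) (g : Fin N → T → T) (ν : Fin N → T → ℂ)
    (hV : CoisometryAssumptions V e g ν)
    (hg : ∀ M, IsMinimalCompactInvariant g ν M → ∀ i, (M ∩ Function.support (ν i)).InjOn (g i))
    (hfin : ∀ M : Set T, IsMinimalCompactInvariant g ν M → M.Finite) :
    {M : Set T | IsMinimalCompactInvariant g ν M}.Finite ∧
    (∀ M : Set T, IsMinimalCompactInvariant g ν M →
      ActsAsRandomWalk V (spanOn e M) (fun t : M => e t) (restrictMaps g M)
        (restrictWeights ν M) ∧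
      WalkIrreducible (restrictMaps g M) (restrictWeights ν M) ∧
      WalkSeparating (restrictMaps g M) (restrictWeights ν M)) ∧
    ((∀ M : Set T, IsMinimalCompactInvariant g ν M →
        WalkReversing V (fun t : M => e t) (restrictMaps g M) (restrictWeights ν M)) →
      ∀ c : ∀ M : {M : Set T // IsMinimalCompactInvariant g ν M}, M.1,
        IsParsevalFrame (fun a : Σ M : {M : Set T // IsMinimalCompactInvariant g ν M},
            wordsNotEndingInCycle (restrictMaps g M.1) (restrictWeights ν M.1) (c M) =>
          wordOp V a.2.1 (e (c a.1)))) := by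
  refine ⟨hV.finite_minimal hg hfin, fun M hM => ⟨?_, ?_, ?_⟩, fun hrev c => ?_⟩
  · exact hV.actsAsRandomWalk hg hfin hM
  · exact hM.walkIrreducible (hfin M hM)
  · exact hV.walkSeparating hM.prop.2.2 (hfin M hM) (hg M hM)
  · exact hV.isParsevalFrame_minimal hg hfin hrev c

theorem theorem2p11 {K : Type*} [NormedAddCommGroup K] [InnerProductSpace ℂ K] [CompleteSpace K]
    {T : Type*} [MetricSpace T] [CompleteSpace T] {N : ℕ}
    (V : Fin N → K →L[ℂ] K) (e : T → K) (g : Fin N → T → T) (ν : Fin N → T → ℂ)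
    (hV : CoisometryAssumptions V e g ν)
    (hg : ∀ i, Function.Injective (g i))
    (hfin : ∀ M : Set T, IsMinimalCompactInvariant g ν M → M.Finite) :
    {M : Set T | IsMinimalCompactInvariant g ν M}.Finite ∧
    (∀ M : Set T, IsMinimalCompactInvariant g ν M →
      ActsAsRandomWalk V (spanOn e M) (fun t : M => e t) (restrictMaps g M)
        (restrictWeights ν M) ∧
      WalkIrreducible (restrictMaps g M) (restrictWeights ν M) ∧
      WalkSeparating (restrictMaps g M) (restrictWeights ν M)) ∧
    ((∀ M : Set T, IsMinimalCompactInvariant g ν M →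
        WalkReversing V (fun t : M => e t) (restrictMaps g M) (restrictWeights ν M)) →
      ∀ c : ∀ M : {M : Set T // IsMinimalCompactInvariant g ν M}, M.1,
        IsParsevalFrame (fun a : Σ M : {M : Set T // IsMinimalCompactInvariant g ν M},
            wordsNotEndingInCycle (restrictMaps g M.1) (restrictWeights ν M.1) (c M) =>
          wordOp V a.2.1 (e (c a.1)))) :=
  theorem2p11_general V e g ν hV (fun _ _ i => (hg i).injOn) hfin
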